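/- **Lemma (Soundness).** *Definitions.* For finite graphs $G,H$ and a bijection $\pi:V(G)\to V(H)$ let $$\mathsf{GI}(G,H;\pi)=\frac{|\{e\in E(G):\pi(e)\in E(H)\}|}{\max\{|E(G)|,|E(H)|\}},\qquad \mathsf{GI}(G,H)=\max_{\pi}\mathsf{GI}(G,H;\pi).$$ A 3XOR instance $\mathcal C$ over a variable set $X$ is a family of equations $C_i:\ x_{j_1}+x_{j_2}+x_{j_3}=b_i$ over $\mathbb Z_2$, each in three distinct variables of $X$; its homogeneous version $\mathcal C^{\mathrm{homog}}$ replaces every $b_i$ by $0$. The graph $G_{\mathcal C}$ has two variable vertices $x\mapsto 0$, $x\mapsto 1$ for each $x\in X$, and, for each equation $C$, four constraint vertices, one for each assignment to the three variables of $C$ that satisfies $C$. Its edges: $x\mapsto 0$ and $x\mapsto 1$ are adjacent for each $x$; the four constraint vertices of each equation form a clique; and each constraint vertex is adjacent to the three variable vertices it is consistent with. There are no other edges. For $m\le\binom n3$, a random 3XOR instance with $n$ variables and $m$ equations is obtained by choosing a uniformly random set of $m$ of the $\binom n3$ unordered triples of distinct variables and giving each chosen triple an independent uniformly random right-hand side in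 $\mathbb Z_2$. *Statement.* There is a function $\varepsilon:\mathbb N\to\mathbb R$ with $\varepsilon(n)\to0$ as $n\to\infty$ such that for all $n$, all real $c\ge 10^{10}$ for which $m=cn$ is an integer, and $m\le\binom n3$, a random 3XOR instance $\mathcal C$ with $n$ variables and $m$ equations satisfies, with probability at least $1-\varepsilon(n)$, $$\mathsf{GI}(G_{\mathcal C},G_{\mathcal C^{\mathrm{homog}}})<1-\frac1{95c^2}.$$ -/

import Mathlib

open Filter Topology

/-! ### Approximate graph isomorphism -/

/-- `giValue G H π` is the number of edges `e` of `G` with `π(e)` an edge of `H`, divided by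
`max (|E(G)|, |E(H)|)`. -/
noncomputable def giValue {V W : Type*} (G : SimpleGraph V) (H : SimpleGraph W) (π : V ≃ W) : ℝ :=
  ({e : Sym2 V | e ∈ G.edgeSet ∧ Sym2.map π e ∈ H.edgeSet}.ncard : ℝ) /
    max (G.edgeSet.ncard : ℝ) (H.edgeSet.ncard : ℝ)

/-- `GI G H` is the maximum of `giValue G H π` over all bijections `π : V(G) → V(H)`
(for finite graphs there are finitely many `π`, so the supremum is a maximum). -/
noncomputable def GI {V W : Type*} (G : SimpleGraph V) (H : SimpleGraph W) : ℝ :=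
  ⨆ π : V ≃ W, giValue G H π

/-! ### 3XOR instances -/

/-- A 3XOR instance over the variable set `X`, with equations indexed by `ι`: the equation `i`
says that the sum over the three distinct variables in `scope i` equals `rhs i`. -/
structure XorInstance (X ι : Type*) where
  scope : ι → Finset X
  card_scope : ∀ i, (scope i).card = 3
  rhs : ι → ZMod 2

namespace XorInstance

variable {X ι : Type*}

/-- The homogeneous version: all right-hand sides are replaced by `0`. -/
def homog (C : XorInstance X ι) : XorInstance X ι where
  scope := C.scope
  card_scope := C.card_scope
  rhs := fun _ => 0

/-- The constraint vertices: pairs of an equation `i` and a partial assignment to its three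
variables that satisfies it. -/
abbrev ConVertex (C : XorInstance X ι) : Type _ :=
  Σ i : ι, {α : C.scope i → ZMod 2 // ∑ x, α x = C.rhs i}

/-- The vertices of the graph: the variable vertices `x ↦ a` and the constraint vertices. -/
abbrev Vertex (C : XorInstance X ι) : Type _ :=
  (X × ZMod 2) ⊕ C.ConVertex

/-- Adjacency: `x ↦ 0` and `x ↦ 1` are adjacent; the four constraint vertices of one equation form
a clique; a constraint vertex is adjacent to the three variable vertices it is consistent with. -/
def adj (C : XorInstance X ι) : C.Vertex → C.Vertex → Prop
  | .inl u, .inl v => u.1 = v.1 ∧ u.2 ≠ v.2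
  | .inr p, .inr q => p.1 = q.1 ∧ p ≠ q
  | .inl u, .inr p => ∃ h : u.1 ∈ C.scope p.1, p.2.1 ⟨u.1, h⟩ = u.2
  | .inr p, .inl u => ∃ h : u.1 ∈ C.scope p.1, p.2.1 ⟨u.1, h⟩ = u.2

/-- The graph associated with a 3XOR instance. -/
def graph (C : XorInstance X ι) : SimpleGraph C.Vertex where
  Adj := C.adj
  symm := ⟨by
    rintro (u | p) (v | q) h
    · exact ⟨h.1.symm, h.2.symm⟩
    · exact h
    · exact h
    · exact ⟨h.1.symm, h.2.symm⟩⟩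
  loopless := ⟨by
    rintro (u | p) h
    · exact h.2 rfl
    · exact h.2 rfl⟩

end XorInstance

/-! ### Random 3XOR instances -/

/-- The unordered triples of distinct variables among `n` variables. -/
abbrev Triple (n : ℕ) : Type := {s : Finset (Fin n) // s.card = 3}

/-- The sets of `m` distinct triples, i.e. the simple 3-uniform hypergraphs on `n` vertices with
`m` edges. -/
abbrev TripleSystem (n m : ℕ) : Type := {E : Finset (Triple n) // E.card = m}

theorem tripleSystem_nonempty {n m : ℕ} (h : m ≤ n.choose 3) : Nonempty (TripleSystem n m) := by
  have hc : m ≤ (Finset.univ : Finset (Triple n)).card := by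
    rw [Finset.card_univ, Fintype.card_finset_len, Fintype.card_fin]
    exact h
  obtain ⟨E, -, hE⟩ := Finset.exists_subset_card_eq hc
  exact ⟨⟨E, hE⟩⟩

/-- The outcomes: a set `E` of `m` triples and a right-hand side for each of them. -/
abbrev XorSample (n m : ℕ) : Type := Σ E : TripleSystem n m, (E.1 → ZMod 2)

/-- The 3XOR instance of an outcome, with the `m` equations indexed by the chosen triples. -/
def XorSample.toInstance {n m : ℕ} (ω : XorSample n m) : XorInstance (Fin n) ω.1.1 where
  scope := fun t => t.1.1
  card_scope := fun t => t.1.2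
  rhs := ω.2

/-- The distribution of a random 3XOR instance with `n` variables and `m` equations: a uniformly
random set of `m` of the `n.choose 3` triples, then independent uniform right-hand sides. -/
noncomputable def random3XOR (n m : ℕ) (h : m ≤ n.choose 3) : PMF (XorSample n m) :=
  haveI := tripleSystem_nonempty h
  (PMF.uniformOfFintype (TripleSystem n m)).bind fun E =>
    (PMF.uniformOfFintype (E.1 → ZMod 2)).map fun b => ⟨E, b⟩

/-- The probability of an event under a discrete distribution. -/
noncomputable def PMF.prob {Ω : Type*} (p : PMF Ω) (A : Set Ω) : ℝ :=
  (p.toOuterMeasure A).toReal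

/-! Suppose a bijection `π` from the graph of `C` to that of `C.homog` loses few edges. If it keeps
every edge at the constraint vertices of an equation, it carries this gadget onto the gadget of a
homogeneous equation: the clique goes to a clique, and each pair `x ↦ 0`, `x ↦ 1` to such a pair,
possibly swapped. The swaps form an assignment, and comparing parities of the two gadgets shows that
it satisfies the equation (`inducedAssignment_satisfies`). Each violated equation therefore costs a
lost edge of its own (`ncard_violated_le`), and a value of at least `1 - δ` yields an assignment
violating at most `δ (n + 28 m)` equations (`exists_assignment_of_le_GI`).

For `δ = 1 / (95 c ^ 2)` this is at most `n`. For any fixed triples, a union bound over the `2 ^ n`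
assignments shows that random right-hand sides rarely permit so few violations
(`ncard_nearly_satisfiable_le`). No property of the random triples is used. -/

/-! ### Parity constraints on three bits -/

section Parity

variable {S : Type*} [Fintype S]

/-- Relabelling the three variables of a parity constraint by `Fin 3`. -/
theorem exists_equiv_fin_three (hS : Fintype.card S = 3) : Nonempty (S ≃ Fin 3) :=
  ⟨Fintype.equivFinOfCardEq hS⟩

theorem card_parity_eq_four (hS : Fintype.card S = 3) (b : ZMod 2) :
    Nat.card {α : S → ZMod 2 // ∑ x, α x = b} = 4 := by
  obtain ⟨e⟩ := exists_equiv_fin_three hS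
  have h : Nat.card {α : Fin 3 → ZMod 2 // ∑ x, α x = b} = 4 := by
    rw [Nat.card_eq_fintype_card]
    revert b
    decide
  rw [← h]
  refine Nat.card_congr ((Equiv.arrowCongr e (Equiv.refl _)).subtypeEquiv fun α => ?_)
  rw [← e.symm.sum_comp]
  rfl

/-- Two of the three bits are free; the third corrects the parity. -/
theorem exists_parity_of_ne (hS : Fintype.card S = 3) (b : ZMod 2) {y z : S} (hyz : y ≠ z)
    (s t : ZMod 2) : ∃ α : S → ZMod 2, ∑ x, α x = b ∧ α y = s ∧ α z = t := by
  obtain ⟨e⟩ := exists_equiv_fin_three hS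
  have h : ∀ (b s t : ZMod 2) (y z : Fin 3), y ≠ z →
      ∃ α : Fin 3 → ZMod 2, ∑ x, α x = b ∧ α y = s ∧ α z = t := by decide
  obtain ⟨α, h₁, h₂, h₃⟩ := h b s t (e y) (e z) (e.injective.ne hyz)
  exact ⟨α ∘ e, by rw [← h₁, ← e.sum_comp]; rfl, h₂, h₃⟩

theorem exists_parity_apply_eq (hS : Fintype.card S = 3) (b : ZMod 2) (y : S) (s : ZMod 2) :
    ∃ α : S → ZMod 2, ∑ x, α x = b ∧ α y = s := by
  have : Nontrivial S := Fintype.one_lt_card_iff_nontrivial.1 (by omega)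
  obtain ⟨z, hz⟩ := exists_ne y
  obtain ⟨α, h₁, h₂, -⟩ := exists_parity_of_ne hS b hz.symm s 0
  exact ⟨α, h₁, h₂⟩

/-- Of three satisfying assignments with the same value at one variable, two agree. -/
theorem parity_pigeonhole (hS : Fintype.card S = 3) {b : ZMod 2} {y : S} {s : ZMod 2}
    {α β γ : S → ZMod 2} (hα : ∑ x, α x = b) (hβ : ∑ x, β x = b) (hγ : ∑ x, γ x = b)
    (hαy : α y = s) (hβy : β y = s) (hγy : γ y = s) : α = β ∨ α = γ ∨ β = γ := by
  obtain ⟨e⟩ := exists_equiv_fin_three hS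
  -- Any `z ≠ y` works: the parity and the bits at `y` and `z` determine the third bit.
  have key : ∀ (y : Fin 3), ∃ z : Fin 3, ∀ α β : Fin 3 → ZMod 2,
      ∑ x, α x = ∑ x, β x → α y = β y → α z = β z → α = β := by decide
  obtain ⟨z, hz⟩ := key (e y)
  have hz' : ∀ α β : S → ZMod 2, ∑ x, α x = b → ∑ x, β x = b → α y = s → β y = s →
      α (e.symm z) = β (e.symm z) → α = β := by
    intro α β hα hβ hαy hβy h
    have := hz (α ∘ e.symm) (β ∘ e.symm)
      (by simp only [Function.comp_apply, e.symm.sum_comp, hα, hβ]) (by simp [hαy, hβy]) h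
    funext x
    simpa using congrFun this (e x)
  have two : ∀ u v w : ZMod 2, u = v ∨ u = w ∨ v = w := by decide
  rcases two (α (e.symm z)) (β (e.symm z)) (γ (e.symm z)) with h | h | h
  · exact .inl (hz' _ _ hα hβ hαy hβy h)
  · exact .inr (.inl (hz' _ _ hα hγ hαy hγy h))
  · exact .inr (.inr (hz' _ _ hβ hγ hβy hγy h))

end Parity

namespace XorInstance

variable {X ι : Type*}

theorem card_coe_scope (C : XorInstance X ι) (i : ι) : Fintype.card (C.scope i) = 3 := by
  rw [Fintype.card_coe, C.card_scope]

/-! ### Gadgets -/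

/-- A variable vertex lies in no clique on four vertices. -/
theorem not_adj_clique_of_variable (C : XorInstance X ι) (u : X × ZMod 2) {v w z : C.Vertex}
    (huv : C.graph.Adj (.inl u) v) (huw : C.graph.Adj (.inl u) w) (huz : C.graph.Adj (.inl u) z)
    (hvw : C.graph.Adj v w) (hvz : C.graph.Adj v z) (hwz : C.graph.Adj w z) : False := by
  -- The only variable vertex adjacent to `u` is its opposite value, and no constraint vertex is
  -- consistent with both, so a triangle at `u` has two constraint vertices.
  have aux : ∀ {v w : C.Vertex}, C.graph.Adj (.inl u) v → C.graph.Adj (.inl u) w →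
      C.graph.Adj v w → ∃ p : C.ConVertex, v = .inr p := by
    rintro (v | p) (w | q) h₁ h₂ h₃
    · obtain ⟨a, a'⟩ := h₁
      obtain ⟨b, b'⟩ := h₂
      obtain ⟨c, c'⟩ := h₃
      have : ∀ r s t : ZMod 2, r ≠ s → r ≠ t → s ≠ t → False := by decide
      exact (this _ _ _ a' b' c').elim
    · obtain ⟨a, a'⟩ := h₁
      obtain ⟨b, b'⟩ := h₂
      obtain ⟨c, c'⟩ := h₃
      obtain ⟨x, r⟩ := u
      obtain ⟨y, s⟩ := v
      obtain rfl : x = y := a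
      exact (a' (b'.symm.trans c')).elim
    · exact ⟨p, rfl⟩
    · exact ⟨p, rfl⟩
  obtain ⟨⟨i, α, hα⟩, rfl⟩ := aux huv huw hvw
  obtain ⟨⟨j, β, hβ⟩, rfl⟩ := aux huw huv hvw.symm
  obtain ⟨⟨k, γ, hγ⟩, rfl⟩ := aux huz huv hvz.symm
  obtain ⟨a, a'⟩ := hvw
  obtain ⟨b, b'⟩ := hvz
  obtain ⟨c, c'⟩ := hwz
  obtain rfl : i = j := a
  obtain rfl : i = k := b
  obtain ⟨h₁, h₁'⟩ := huv
  obtain ⟨h₂, h₂'⟩ := huw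
  obtain ⟨h₃, h₃'⟩ := huz
  rcases parity_pigeonhole (C.card_coe_scope i) hα hβ hγ h₁' h₂' h₃' with rfl | rfl | rfl
  · exact a' rfl
  · exact b' rfl
  · exact c' rfl

theorem adj_constraint {C : XorInstance X ι} {i : ι} {α β : {α : C.scope i → ZMod 2 //
    ∑ x, α x = C.rhs i}} (h : α ≠ β) :
    C.graph.Adj (.inr ⟨i, α⟩) (.inr ⟨i, β⟩) :=
  ⟨rfl, fun e => h (eq_of_heq (Sigma.mk.inj e).2)⟩

/-- A map that embeds the clique of one equation into the graph of an instance maps it onto the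
clique of an equation. -/
theorem exists_constraint_of_clique {C D : XorInstance X ι} {i : ι}
    (f : {α : C.scope i → ZMod 2 // ∑ x, α x = C.rhs i} → D.Vertex)
    (hf : ∀ α β, α ≠ β → D.graph.Adj (f α) (f β)) :
    ∃ (j : ι) (g : {α : C.scope i → ZMod 2 // ∑ x, α x = C.rhs i} →
      {β : D.scope j → ZMod 2 // ∑ x, β x = D.rhs j}),
      Function.Bijective g ∧ ∀ α, f α = .inr ⟨j, g α⟩ := by
  classical
  have hcard := card_parity_eq_four (C.card_coe_scope i) (C.rhs i)
  have hne : ∀ α, ∃ p, f α = .inr p := by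
    intro α
    rcases hα : f α with u | p
    · exfalso
      have h3 : (Finset.univ.erase α).card = 3 := by
        rw [Finset.card_erase_of_mem (Finset.mem_univ _), Finset.card_univ,
          ← Nat.card_eq_fintype_card, hcard]
      obtain ⟨β, γ, δ, h₁, h₂, h₃, h⟩ := Finset.card_eq_three.1 h3
      have hβ : β ≠ α := Finset.ne_of_mem_erase (s := Finset.univ)
        (by rw [h]; simp only [Finset.mem_insert, Finset.mem_singleton, true_or])
      have hγ : γ ≠ α := Finset.ne_of_mem_erase (s := Finset.univ)
        (by rw [h]; simp only [Finset.mem_insert, Finset.mem_singleton, true_or, or_true])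
      have hδ : δ ≠ α := Finset.ne_of_mem_erase (s := Finset.univ)
        (by rw [h]; simp only [Finset.mem_insert, Finset.mem_singleton, or_true])
      exact D.not_adj_clique_of_variable u (hα ▸ hf _ _ hβ.symm) (hα ▸ hf _ _ hγ.symm)
        (hα ▸ hf _ _ hδ.symm) (hf _ _ h₁) (hf _ _ h₂) (hf _ _ h₃)
    · exact ⟨p, rfl⟩
  choose p hp using hne
  have : Nonempty {α : C.scope i → ZMod 2 // ∑ x, α x = C.rhs i} :=
    (Nat.card_pos_iff.1 (by omega)).1
  obtain ⟨α₀⟩ := this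
  have hj : ∀ α, ∃ β, p α = ⟨(p α₀).1, β⟩ := by
    intro α
    by_cases h : α = α₀
    · exact ⟨(p α₀).2, by rw [h]⟩
    · have h1 := hf α α₀ h
      rw [hp, hp] at h1
      have h2 : (p α).1 = (p α₀).1 := h1.1
      rw [← h2]
      exact ⟨(p α).2, rfl⟩
  choose g hg using hj
  refine ⟨(p α₀).1, g, ?_, fun α => by rw [hp, hg]⟩
  rw [Nat.bijective_iff_injective_and_card]
  refine ⟨fun α β h => ?_, by rw [hcard, card_parity_eq_four (D.card_coe_scope _)]⟩
  by_contra hne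
  exact (hf α β hne).ne (by rw [hp, hp, hg α, hg β, h])

/-! ### Reading an assignment off a bijection -/

/-- The assignment to the variables read off from a bijection of vertices. -/
def inducedAssignment {C D : XorInstance X ι} (π : C.Vertex ≃ D.Vertex) (x : X) : ZMod 2 :=
  match π (.inl (x, 0)) with
  | .inl u => u.2
  -- Junk value: it is not reached at variables of an equation whose constraint-vertex edges are all
  -- preserved.
  | .inr _ => 0

/-- If a bijection preserves all edges at the constraint vertices of an equation, the induced
assignment satisfies this equation. -/
theorem inducedAssignment_satisfies {C D : XorInstance X ι} (hD : ∀ j, D.rhs j = 0)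
    (π : C.Vertex ≃ D.Vertex) (i : ι)
    (hπ : ∀ α v, C.graph.Adj (.inr ⟨i, α⟩) v → D.graph.Adj (π (.inr ⟨i, α⟩)) (π v)) :
    ∑ x ∈ C.scope i, inducedAssignment π x = C.rhs i := by
  classical
  obtain ⟨j, g, hg, hfg⟩ := exists_constraint_of_clique (C := C) (D := D) (i := i)
    (fun α => π (.inr ⟨i, α⟩)) fun α β h => hπ _ _ (adj_constraint h)
  -- A constraint vertex adjacent to the clique of `j` would lie in it, but all four of its vertices
  -- are already images of constraint vertices.
  have hvar : ∀ (x : C.scope i) (t : ZMod 2), ∃ (y : D.scope j) (s : ZMod 2),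
      π (.inl (x.1, t)) = .inl (y.1, s) ∧ ∀ α, α.1 x = t → (g α).1 y = s := by
    intro x t
    have hadj : ∀ α, α.1 x = t → D.graph.Adj (.inr ⟨j, g α⟩) (π (.inl (x.1, t))) := by
      intro α hα
      rw [← hfg]
      exact hπ _ _ ⟨x.2, hα⟩
    obtain ⟨α, hα, hαx⟩ := exists_parity_apply_eq (C.card_coe_scope i) (C.rhs i) x t
    have h := hadj ⟨α, hα⟩ hαx
    rcases hv : π (.inl (x.1, t)) with ⟨y, s⟩ | ⟨k, β⟩
    · rw [hv] at h
      obtain ⟨hy, -⟩ := h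
      refine ⟨⟨y, hy⟩, s, rfl, fun γ hγ => ?_⟩
      have h' := hadj γ hγ
      rw [hv] at h'
      exact h'.2
    · rw [hv] at h
      obtain rfl : j = k := h.1
      obtain ⟨γ, rfl⟩ := hg.2 β
      rw [← hfg] at hv
      exact absurd (π.injective hv) (by simp)
  choose y s hys hcons using hvar
  -- Otherwise some satisfying `β` takes the wrong value at both variables, yet its preimage gives
  -- `x` one of the two values.
  have hy : ∀ x, y x 0 = y x 1 := by
    intro x
    by_contra hne
    obtain ⟨β, hβ, h₀, h₁⟩ := exists_parity_of_ne (D.card_coe_scope j) (D.rhs j) hne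
      (s x 0 + 1) (s x 1 + 1)
    obtain ⟨α, hα⟩ := hg.2 ⟨β, hβ⟩
    have hβα : β = (g α).1 := by rw [hα]
    have two : ∀ t : ZMod 2, t = 0 ∨ t = 1 := by decide
    rcases two (α.1 x) with h | h
    · rw [hβα, hcons x _ α h] at h₀
      simp at h₀
    · rw [hβα, hcons x _ α h] at h₁
      simp at h₁
  have hs : ∀ x t, s x t = s x 0 + t := by
    intro x t
    have h01 : s x 0 ≠ s x 1 := by
      intro h
      have h' : π (.inl (x.1, 0)) = π (.inl (x.1, 1)) := by rw [hys, hys, h, hy]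
      simpa using π.injective h'
    have : ∀ (f : ZMod 2 → ZMod 2), f 0 ≠ f 1 → ∀ t, f t = f 0 + t := by decide
    exact this (s x) h01 t
  have hyt : ∀ x t, y x t = y x 0 := by
    intro x t
    have two : ∀ t : ZMod 2, t = 0 ∨ t = 1 := by decide
    rcases two t with rfl | rfl
    · rfl
    · exact (hy x).symm
  have hbij : Function.Bijective fun x => y x 0 := by
    rw [Fintype.bijective_iff_injective_and_card]
    refine ⟨fun x x' h => ?_, by rw [C.card_coe_scope, D.card_coe_scope]⟩
    have h' : π (.inl (x.1, 0)) = π (.inl (x'.1, s x 0 - s x' 0)) := by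
      rw [hys, hys, hyt x', hs x' (s x 0 - s x' 0)]
      simp only at h
      rw [h]
      simp
    have h'' := π.injective h'
    simp only [Sum.inl.injEq, Prod.mk.injEq] at h''
    exact Subtype.ext h''.1
  have ha : ∀ x : C.scope i, inducedAssignment π x.1 = s x 0 := by
    intro x
    simp only [inducedAssignment, hys]
  obtain ⟨x₀⟩ : Nonempty (C.scope i) := Fintype.card_pos_iff.1 (by rw [C.card_coe_scope]; omega)
  obtain ⟨α, hα, -⟩ := exists_parity_apply_eq (C.card_coe_scope i) (C.rhs i) x₀ 0
  have hsum := (g ⟨α, hα⟩).2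
  replace hsum := hsum.trans (hD j)
  rw [← hbij.sum_comp] at hsum
  -- Up to relabelling, `g` adds the induced assignment to `α`; summing over the scope gives `0` on
  -- one side and adds `C.rhs i` on the other.
  have hterm : ∀ x, (g ⟨α, hα⟩).1 (y x 0) = inducedAssignment π x.1 + α x := by
    intro x
    rw [← hyt x (α x), hcons x (α x) _ rfl, hs, ha]
  simp only [hterm, Finset.sum_add_distrib, hα] at hsum
  rw [← Finset.sum_coe_sort (C.scope i)]
  have : ∀ u v : ZMod 2, u + v = 0 → u = v := by decide
  exact this _ _ hsum

instance [Finite X] [Finite ι] (C : XorInstance X ι) : Finite C.Vertex := by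
  unfold Vertex ConVertex
  infer_instance

/-! ### Edge counts -/

theorem ncard_range_le {α β : Type*} [Finite α] (f : α → β) :
    (Set.range f).ncard ≤ Nat.card α := by
  rw [← Set.image_univ, ← Set.ncard_univ]
  exact Set.ncard_image_le

/-- The graph of an instance has at most `n + 28 m` edges. -/
theorem ncard_edgeSet_le [Finite X] [Finite ι] (C : XorInstance X ι) :
    C.graph.edgeSet.ncard ≤ Nat.card X + 28 * Nat.card ι := by
  classical
  let A (i : ι) := {α : C.scope i → ZMod 2 // ∑ x, α x = C.rhs i}
  let f₁ : X → Sym2 C.Vertex := fun x => s(.inl (x, 0), .inl (x, 1))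
  -- Ordered pairs, diagonal included, give the crude `16` per equation; with the `12` of `f₃` this
  -- makes `28`.
  let f₂ : (Σ i, A i × A i) → Sym2 C.Vertex := fun p =>
    s(.inr ⟨p.1, p.2.1⟩, .inr ⟨p.1, p.2.2⟩)
  let f₃ : (Σ i, A i × C.scope i) → Sym2 C.Vertex := fun p =>
    s(.inr ⟨p.1, p.2.1⟩, .inl (p.2.2.1, p.2.1.1 p.2.2))
  have hsub : C.graph.edgeSet ⊆ (Set.range f₁ ∪ Set.range f₂) ∪ Set.range f₃ := by
    intro e
    induction e using Sym2.ind with | _ v w =>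
    intro h
    rcases v with ⟨x, s⟩ | ⟨i, α⟩ <;> rcases w with ⟨y, t⟩ | ⟨j, β⟩
    · obtain ⟨h₁, h₂⟩ := h
      obtain rfl : x = y := h₁
      left; left
      refine ⟨x, ?_⟩
      have : ∀ s t : ZMod 2, s ≠ t → (s = 0 ∧ t = 1) ∨ (s = 1 ∧ t = 0) := by decide
      rcases this s t h₂ with ⟨rfl, rfl⟩ | ⟨rfl, rfl⟩
      · rfl
      · exact Sym2.eq_swap
    · obtain ⟨h₁, h₂⟩ := h
      refine .inr ⟨⟨j, β, ⟨x, h₁⟩⟩, ?_⟩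
      change s((Sum.inr ⟨j, β⟩ : C.Vertex), Sum.inl (x, β.1 ⟨x, h₁⟩)) = _
      rw [show β.1 ⟨x, h₁⟩ = s from h₂]
      exact Sym2.eq_swap
    · obtain ⟨h₁, h₂⟩ := h
      refine .inr ⟨⟨i, α, ⟨y, h₁⟩⟩, ?_⟩
      change s((Sum.inr ⟨i, α⟩ : C.Vertex), Sum.inl (y, α.1 ⟨y, h₁⟩)) = _
      rw [show α.1 ⟨y, h₁⟩ = t from h₂]
    · obtain ⟨h₁, h₂⟩ := h
      obtain rfl : i = j := h₁
      exact .inl (.inr ⟨⟨i, α, β⟩, rfl⟩)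
  have hA : ∀ i, Nat.card (A i) = 4 := fun i => card_parity_eq_four (C.card_coe_scope i) _
  have := Fintype.ofFinite ι
  have h₂ : Nat.card (Σ i, A i × A i) = 16 * Nat.card ι := by
    rw [Nat.card_sigma, Finset.sum_congr rfl fun i _ => by rw [Nat.card_prod, hA]]
    simp [mul_comm]
  have h₃ : Nat.card (Σ i, A i × C.scope i) = 12 * Nat.card ι := by
    rw [Nat.card_sigma, Finset.sum_congr rfl fun i _ => by
      rw [Nat.card_prod, hA, Nat.card_eq_fintype_card, C.card_coe_scope]]
    simp [mul_comm]
  have hx₁ := ncard_range_le f₁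
  have hx₂ := ncard_range_le f₂
  have hx₃ := ncard_range_le f₃
  rw [h₂] at hx₂
  rw [h₃] at hx₃
  calc _ ≤ _ := Set.ncard_le_ncard hsub
    _ ≤ _ := Set.ncard_union_le _ _
    _ ≤ _ := Nat.add_le_add_right (Set.ncard_union_le _ _) _
    _ ≤ _ := by omega

/-! ### From lost edges to violated equations -/

/-- The equations violated by the induced assignment are at most as many as the edges that the
bijection does not preserve. -/
theorem ncard_violated_le {C D : XorInstance X ι} [Finite X] [Finite ι] (hD : ∀ j, D.rhs j = 0)
    (π : C.Vertex ≃ D.Vertex) :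
    {i | ∑ x ∈ C.scope i, inducedAssignment π x ≠ C.rhs i}.ncard ≤
      {e | e ∈ C.graph.edgeSet ∧ Sym2.map π e ∉ D.graph.edgeSet}.ncard := by
  have key : ∀ i ∈ {i | ∑ x ∈ C.scope i, inducedAssignment π x ≠ C.rhs i}, ∃ e : Sym2 C.Vertex,
      (e ∈ C.graph.edgeSet ∧ Sym2.map π e ∉ D.graph.edgeSet) ∧ ∃ α, .inr ⟨i, α⟩ ∈ e := by
    intro i hi
    by_contra! h
    exact hi (inducedAssignment_satisfies hD π i fun α v h₁ => by
      by_contra h₂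
      exact h s(.inr ⟨i, α⟩, v) ⟨h₁, h₂⟩ α (Sym2.mem_mk_left _ _))
  rcases Set.eq_empty_or_nonempty {i | ∑ x ∈ C.scope i, inducedAssignment π x ≠ C.rhs i}
    with h | ⟨i₀, h₀⟩
  · rw [h, Set.ncard_empty]
    exact Nat.zero_le _
  have : Nonempty (Sym2 C.Vertex) := ⟨(key i₀ h₀).choose⟩
  choose! e he using key
  refine Set.ncard_le_ncard_of_injOn e (fun i hi => (he i hi).1) ?_ (Set.toFinite _)
  intro i hi j hj hij
  obtain ⟨⟨h₁, -⟩, α, hα⟩ := he i hi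
  obtain ⟨-, β, hβ⟩ := he j hj
  rw [← hij] at hβ
  by_contra hne
  have hv : (Sum.inr ⟨i, α⟩ : C.Vertex) ≠ .inr ⟨j, β⟩ := by
    intro h
    exact hne (congrArg Sigma.fst (Sum.inr.inj h))
  -- No edge joins constraint vertices of different equations, so the chosen lost edges are
  -- distinct.
  rw [(Sym2.mem_and_mem_iff hv).1 ⟨hα, hβ⟩] at h₁
  exact hne h₁.1

/-- If the value of the graph pair is close to one, then some assignment violates few equations. -/
theorem exists_assignment_of_le_GI [Finite X] [Finite ι] (C : XorInstance X ι) {δ : ℝ}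
    (hδ : 0 ≤ δ) (hδ' : δ < 1) (h : 1 - δ ≤ GI C.graph C.homog.graph) :
    ∃ a : X → ZMod 2, ({i | ∑ x ∈ C.scope i, a x ≠ C.rhs i}.ncard : ℝ) ≤
      δ * (Nat.card X + 28 * Nat.card ι) := by
  cases isEmpty_or_nonempty (C.Vertex ≃ C.homog.Vertex) with
  | inl he =>
    rw [GI, Real.iSup_of_isEmpty] at h
    linarith
  | inr hne =>
    obtain ⟨π, hπ⟩ := exists_eq_ciSup_of_finite (f := giValue C.graph C.homog.graph)
    rw [GI, ← hπ, giValue] at h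
    refine ⟨inducedAssignment π, ?_⟩
    have hv : ({i | ∑ x ∈ C.scope i, inducedAssignment π x ≠ C.rhs i}.ncard : ℝ) ≤ _ :=
      Nat.cast_le.2 (ncard_violated_le (D := C.homog) (fun _ => rfl) π)
    have hsplit := Set.ncard_inter_add_ncard_sdiff_eq_ncard C.graph.edgeSet
      {e | Sym2.map π e ∈ C.homog.graph.edgeSet} (Set.toFinite _)
    have hG : (C.graph.edgeSet.ncard : ℝ) ≤ (Nat.card X + 28 * Nat.card ι : ℕ) :=
      Nat.cast_le.2 C.ncard_edgeSet_le
    have hH : (C.homog.graph.edgeSet.ncard : ℝ) ≤ (Nat.card X + 28 * Nat.card ι : ℕ) :=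
      Nat.cast_le.2 C.homog.ncard_edgeSet_le
    push_cast at hG hH
    have hM := max_le hG hH
    set M := max (C.graph.edgeSet.ncard : ℝ) (C.homog.graph.edgeSet.ncard : ℝ) with hMdef
    have hGM : (C.graph.edgeSet.ncard : ℝ) ≤ M := le_max_left _ _
    have hM0 : 0 ≤ M := le_trans (Nat.cast_nonneg _) hGM
    have hpres : (1 - δ) * M ≤
        ({e : Sym2 C.Vertex | e ∈ C.graph.edgeSet ∧
          Sym2.map π e ∈ C.homog.graph.edgeSet}.ncard : ℝ) := by
      rcases hM0.eq_or_lt with h0 | h0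
      · rw [← h0, mul_zero]
        exact Nat.cast_nonneg _
      · exact (le_div_iff₀ h0).1 h
    have hsplit' : ({e : Sym2 C.Vertex | e ∈ C.graph.edgeSet ∧
          Sym2.map π e ∈ C.homog.graph.edgeSet}.ncard : ℝ) +
        ({e : Sym2 C.Vertex | e ∈ C.graph.edgeSet ∧
          Sym2.map π e ∉ C.homog.graph.edgeSet}.ncard : ℝ) = C.graph.edgeSet.ncard := by
      exact_mod_cast hsplit
    have := mul_le_mul_of_nonneg_left hM hδ
    linarith

end XorInstance

/-! ### Counting right-hand sides -/

section Counting

variable {ι : Type*} [Fintype ι]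

/-- The number of bit vectors within Hamming distance `r` of a given one. -/
theorem ncard_hammingBall_le (t : ι → ZMod 2) (r : ℕ) :
    ({b : ι → ZMod 2 | {i | t i ≠ b i}.ncard ≤ r}.ncard : ℝ) ≤
      2 ^ r * (3 / 2 : ℝ) ^ Fintype.card ι := by
  classical
  -- Weight each `b` by `(1 / 2)` to its distance from `t`. The total factors into `1 + 1 / 2` per
  -- coordinate, and points of the ball weigh at least `(1 / 2) ^ r`.
  have hsum : ∑ b : ι → ZMod 2, ∏ i, (if t i ≠ b i then (1 / 2 : ℝ) else 1) =
      (3 / 2 : ℝ) ^ Fintype.card ι := by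
    rw [← Fintype.piFinset_univ,
      Finset.sum_prod_piFinset Finset.univ fun i (s : ZMod 2) => if t i ≠ s then (1 / 2 : ℝ) else 1]
    rw [← Finset.card_univ, ← Finset.prod_const]
    refine Finset.prod_congr rfl fun i _ => ?_
    have two : ∀ t : ZMod 2, t = 0 ∨ t = 1 := by decide
    rw [show (Finset.univ : Finset (ZMod 2)) = {0, 1} from rfl,
      Finset.sum_pair (by decide : (0 : ZMod 2) ≠ 1)]
    rcases two (t i) with h | h <;> norm_num [h]
  have hprod : ∀ b : ι → ZMod 2, ∏ i, (if t i ≠ b i then (1 / 2 : ℝ) else 1) =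
      (1 / 2) ^ {i | t i ≠ b i}.ncard := by
    intro b
    rw [Finset.prod_ite, Finset.prod_const, Finset.prod_const_one, mul_one,
      Set.ncard_eq_toFinset_card']
    congr 2
    ext i
    simp
  rw [← hsum, Finset.mul_sum, Set.ncard_eq_toFinset_card', ← nsmul_one (Finset.card _),
    ← Finset.sum_const]
  refine (Finset.sum_le_sum fun b hb => ?_).trans
    (Finset.sum_le_univ_sum_of_nonneg (fun b => ?_) :
      ∑ b ∈ {b : ι → ZMod 2 | {i | t i ≠ b i}.ncard ≤ r}.toFinset, _ ≤ _)
  · rw [hprod]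
    have hb' : {i | t i ≠ b i}.ncard ≤ r := by simpa using hb
    calc (1 : ℝ) = 2 ^ r * (1 / 2) ^ r := by rw [← mul_pow]; norm_num
      _ ≤ _ := mul_le_mul_of_nonneg_left
        (pow_le_pow_of_le_one (by norm_num) (by norm_num) hb') (by positivity)
  · rw [hprod]
    positivity

/-- Union bound over all assignments. -/
theorem ncard_nearly_satisfiable_le {X : Type*} [Fintype X] (scope : ι → Finset X) (r : ℕ) :
    ({b : ι → ZMod 2 | ∃ a : X → ZMod 2, {i | ∑ x ∈ scope i, a x ≠ b i}.ncard ≤ r}.ncard : ℝ) ≤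
      2 ^ Fintype.card X * (2 ^ r * (3 / 2 : ℝ) ^ Fintype.card ι) := by
  classical
  have hU : {b : ι → ZMod 2 | ∃ a : X → ZMod 2, {i | ∑ x ∈ scope i, a x ≠ b i}.ncard ≤ r} =
      ⋃ a ∈ (Finset.univ : Finset (X → ZMod 2)),
        {b : ι → ZMod 2 | {i | ∑ x ∈ scope i, a x ≠ b i}.ncard ≤ r} := by
    ext b
    simp
  rw [hU]
  calc _ ≤ ((∑ a : X → ZMod 2,
        {b : ι → ZMod 2 | {i | ∑ x ∈ scope i, a x ≠ b i}.ncard ≤ r}.ncard : ℕ) : ℝ) :=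
        Nat.cast_le.2 (Finset.set_ncard_biUnion_le _ _)
    _ ≤ ∑ a : X → ZMod 2, 2 ^ r * (3 / 2 : ℝ) ^ Fintype.card ι := by
        push_cast
        exact Finset.sum_le_sum fun a _ => ncard_hammingBall_le (fun i => ∑ x ∈ scope i, a x) r
    _ = _ := by
        rw [Finset.sum_const, Finset.card_univ, Fintype.card_fun, ZMod.card, nsmul_eq_mul]
        push_cast
        rfl

end Counting

/-! ### Probability -/

theorem PMF.toOuterMeasure_le_one {Ω : Type*} (p : PMF Ω) (A : Set Ω) :
    p.toOuterMeasure A ≤ 1 := by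
  rw [PMF.toOuterMeasure_apply, ← p.tsum_coe]
  exact ENNReal.tsum_le_tsum fun x => Set.indicator_le_self A p x

/-- A lower bound that holds for every triple system holds for the random instance. -/
theorem le_prob_random3XOR {n m : ℕ} (hm : m ≤ n.choose 3) (A : Set (XorSample n m)) {p : ℝ}
    (h : ∀ E : TripleSystem n m,
      ({b : E.1 → ZMod 2 | (⟨E, b⟩ : XorSample n m) ∉ A}.ncard : ℝ) ≤ (1 - p) * 2 ^ m) :
    p ≤ (random3XOR n m hm).prob A := by
  classical
  have hne := tripleSystem_nonempty hm
  rw [PMF.prob, random3XOR, ← ENNReal.ofReal_le_iff_le_toReal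
    (ne_top_of_le_ne_top ENNReal.one_ne_top (PMF.toOuterMeasure_le_one _ _)),
    PMF.toOuterMeasure_bind_apply]
  have key : ∀ E : TripleSystem n m, ENNReal.ofReal p ≤
      ((PMF.uniformOfFintype (E.1 → ZMod 2)).map
        fun b => (⟨E, b⟩ : XorSample n m)).toOuterMeasure A := by
    intro E
    rw [PMF.toOuterMeasure_map_apply, PMF.toOuterMeasure_uniformOfFintype_apply]
    set B := (fun b => (⟨E, b⟩ : XorSample n m)) ⁻¹' A with hB
    have hcard : Fintype.card (E.1 → ZMod 2) = 2 ^ m := by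
      rw [Fintype.card_fun, ZMod.card, Fintype.card_coe, E.2]
    have hsplit : B.ncard + Bᶜ.ncard = 2 ^ m := by
      rw [Set.ncard_add_ncard_compl, Nat.card_eq_fintype_card, hcard]
    have hsplit' : (B.ncard : ℝ) + (Bᶜ.ncard : ℝ) = 2 ^ m := by exact_mod_cast hsplit
    have hE : (Bᶜ.ncard : ℝ) ≤ (1 - p) * 2 ^ m := h E
    have hBc : Fintype.card B = B.ncard := by
      rw [← Nat.card_eq_fintype_card, Nat.card_coe_set_eq]
    rw [hcard, hBc, ENNReal.le_div_iff_mul_le (by simp) (by simp)]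
    calc ENNReal.ofReal p * ((2 ^ m : ℕ) : ENNReal)
        = ENNReal.ofReal (p * 2 ^ m) := by
          rw [ENNReal.ofReal_mul' (by positivity), ENNReal.ofReal_pow (by norm_num)]
          simp
      _ ≤ ENNReal.ofReal B.ncard := ENNReal.ofReal_le_ofReal (by linarith)
      _ = _ := ENNReal.ofReal_natCast _
  calc ENNReal.ofReal p
      = ∑' E, PMF.uniformOfFintype (TripleSystem n m) E * ENNReal.ofReal p := by
        rw [ENNReal.tsum_mul_right, PMF.tsum_coe, one_mul]
    _ ≤ _ := ENNReal.tsum_le_tsum fun E => mul_le_mul_right (key E) _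

/-! ### The soundness bound -/

theorem mainTheorem5 :
    ∃ ε : ℕ → ℝ, Tendsto ε atTop (𝓝 0) ∧
      ∀ (n m : ℕ) (c : ℝ) (hm : m ≤ n.choose 3), (10 : ℝ) ^ 10 ≤ c → (m : ℝ) = c * n →
        1 - ε n ≤ (random3XOR n m hm).prob
          {ω | GI ω.toInstance.graph ω.toInstance.homog.graph < 1 - 1 / (95 * c ^ 2)} := by
  refine ⟨fun n => (1 / 2) ^ n,
    tendsto_pow_atTop_nhds_zero_of_lt_one (by norm_num) (by norm_num), ?_⟩
  intro n m c hm hc hmc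
  refine le_prob_random3XOR hm _ fun E => ?_
  have hc1 : (1 : ℝ) ≤ c := le_trans (by norm_num) hc
  have hcpos : 0 < 95 * c ^ 2 := by positivity
  have hδ : 1 / (95 * c ^ 2) < 1 := by
    rw [div_lt_one hcpos]
    nlinarith
  have hn : (0 : ℝ) ≤ n := Nat.cast_nonneg n
  have hnm : 10 * n ≤ m := by
    have : (10 : ℝ) * n ≤ m := by
      rw [hmc]
      exact mul_le_mul_of_nonneg_right (le_trans (by norm_num) hc) hn
    exact_mod_cast this
  have hcardE : Fintype.card E.1 = m := by rw [Fintype.card_coe, E.2]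
  have hsub : {b : E.1 → ZMod 2 | (⟨E, b⟩ : XorSample n m) ∉
        {ω : XorSample n m | GI (XorSample.toInstance ω).graph
          (XorSample.toInstance ω).homog.graph < 1 - 1 / (95 * c ^ 2)}} ⊆
      {b : E.1 → ZMod 2 | ∃ a : Fin n → ZMod 2,
        {i : E.1 | ∑ x ∈ i.1.1, a x ≠ b i}.ncard ≤ n} := by
    intro b hb
    obtain ⟨a, ha⟩ := XorInstance.exists_assignment_of_le_GI _ (by positivity) hδ (not_lt.1 hb)
    refine ⟨a, ?_⟩
    rw [Nat.card_eq_fintype_card, Nat.card_eq_fintype_card, Fintype.card_fin, hcardE, hmc] at ha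
    -- The left side is of order `n / c`; the cruder radius `n` suffices for the union bound.
    have hle : 1 / (95 * c ^ 2) * (n + 28 * (c * n)) ≤ (n : ℝ) := by
      rw [one_div, inv_mul_le_iff₀ hcpos]
      have h1 : 1 + 28 * c ≤ 95 * c ^ 2 := by nlinarith
      nlinarith [mul_le_mul_of_nonneg_right h1 hn]
    exact_mod_cast ha.trans hle
  calc _ ≤ ({b : E.1 → ZMod 2 | ∃ a : Fin n → ZMod 2,
        {i : E.1 | ∑ x ∈ i.1.1, a x ≠ b i}.ncard ≤ n}.ncard : ℝ) :=
        Nat.cast_le.2 (Set.ncard_le_ncard hsub)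
    _ ≤ 2 ^ n * (2 ^ n * (3 / 2 : ℝ) ^ m) := by
        have := ncard_nearly_satisfiable_le (fun i : E.1 => i.1.1) n
        rwa [Fintype.card_fin, hcardE] at this
    _ = (4 ^ n * (3 / 4 : ℝ) ^ m) * 2 ^ m := by
        rw [mul_assoc, ← mul_pow, ← mul_assoc, ← mul_pow]
        norm_num
    _ ≤ (1 - (1 - (1 / 2) ^ n)) * 2 ^ m := by
        refine mul_le_mul_of_nonneg_right ?_ (by positivity)
        calc (4 : ℝ) ^ n * (3 / 4 : ℝ) ^ m ≤ 4 ^ n * (3 / 4) ^ (10 * n) :=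
              mul_le_mul_of_nonneg_left
                (pow_le_pow_of_le_one (by norm_num) (by norm_num) hnm) (by positivity)
          _ = (4 * (3 / 4) ^ 10) ^ n := by rw [pow_mul, mul_pow]
          -- `4 * (3 / 4) ^ 10` is about `0.23`, which is why `m ≥ 10 n` is enough.
          _ ≤ (1 / 2) ^ n := pow_le_pow_left₀ (by positivity) (by norm_num) n
          _ = _ := by ring
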